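/- **Model.** Let $n\ge 2$, let $\Omega$ be a finite state space with a full-support common prior $\mu$ ($\mu(\omega)>0$ for all $\omega$, $\sum_\omega\mu(\omega)=1$), and let each player $i\in\{1,\dots,n\}$ have a partition $\Pi_i$ of $\Omega$; $\Pi_i(\omega)$ denotes the atom containing $\omega$. The *common knowledge components* (CKCs) are the atoms of the finest common coarsening of $\Pi_1,\dots,\Pi_n$. Let $S$ be a countably infinite set of signals. Oracle $j\in\{1,2\}$ has a partition $F_j$ of $\Omega$. A signaling strategy of Oracle $j$ is an $F_j$-measurable map $\tau_j$ from $\Omega$ to the finitely supported probability distributions on $S$; write $\tau_j(s\mid\omega)$ for the probability of $s$ in state $\omega$. The posterior of player $i$ at $(\omega,s)$ with $\tau(s\mid\omega)>0$ is the probability $\mu^i_{\tau\mid\omega,s}$ on $\Pi_i(\omega)$ proportional to $\mu(\cdot)\,\tau(s\mid\cdot)$. **Games and dominance.** A game $G$ consists of a non-empty finite action set $A_i$ and a utility $u_i:\Omega\times A\to\mathbb R$ for each player, where $A=\prod_i A_i$. Given a game $G$ and a signaling strategy $\tau$, nature draws $\omega$ from $\mu$ and $s$ from $\tau(\cdot\mid\omega)$,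 and player $i$ observes $\Pi_i(\omega)$ and $s$. Player $i$'s strategy is a map $\sigma_i:\Pi_i\times S\to\Delta(A_i)$ that depends on the signal only through the profile of posteriors it induces: $\sigma_i(\Pi_i(\omega),s)=\sigma_i(\Pi_i(\omega),t)$ whenever, for every $\omega'$ in the CKC of $\omega$, $\tau(s\mid\omega')>0\iff\tau(t\mid\omega')>0$ and, in that case, $\mu^k_{\tau\mid\omega',s}=\mu^k_{\tau\mid\omega',t}$ for every player $k$. A profile $\sigma$ of such strategies is a Nash equilibrium of $G(\tau)$ if, for every player $i$ and every $(\omega,s)$ with $\tau(s\mid\omega)>0$, the mixed action $\sigma_i(\Pi_i(\omega),s)$ maximizes $i$'s expected payoff, under the posterior $\mu^i_{\tau\mid\omega,s}$ and given $\sigma_{-i}$, over all of $\Delta(A_i)$. Let $\mathrm{NED}(G(\tau))$ be the set of distributions on $\Omega\times A$ of the form $(\omega,a)\mapsto\mu(\omega)\sum_{s}\tau(s\mid\omega)\prod_i\sigma_i(a_i\mid\Pi_i(\omega),s)$ with $\sigma$ a Nash equilibrium of $G(\tau)$. *Oracle 1 dominates Oracle 2* if for every signaling strategy $\tau_2$ of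 Oracle 2 and every game $G$ there is a signaling strategy $\tau_1$ of Oracle 1 with $\mathrm{NED}(G(\tau_1))=\mathrm{NED}(G(\tau_2))$. **Loops.** An *$F_1$-loop* is a sequence of states $(\omega_1,\overline\omega_1,\dots,\omega_m,\overline\omega_m)$ with $m\ge2$ such that, with indices taken modulo $m$, for all $j$: $\omega_j\ne\overline\omega_j$ lie in the same CKC; $\omega_{j+1}$ and $\overline\omega_j$ lie in the same atom of $F_1$; $\omega_j$ and $\omega_{j+1}$ lie in different CKCs; and the sets $\{\overline\omega_j,\omega_{j+1}\}$, $j=1,\dots,m$, are pairwise disjoint. **Theorem.** Suppose there is no $F_1$-loop. Then Oracle 1 dominates Oracle 2 if and only if $F_1$ refines $F_2$ in every CKC, that is, any two states of the same CKC that lie in the same atom of $F_1$ also lie in the same atom of $F_2$. -/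

import Mathlib

/-! Guided games. A partition of `Ω` is given by its equivalence relation (a `Setoid`); the atoms are
the equivalence classes, and the relation is finer when it is smaller. -/

namespace GuidedGame

noncomputable section

/-- The common knowledge components of the partitions `P i`: the atoms of their finest common
coarsening (the supremum of the equivalence relations). -/
def ckc {n : ℕ} {Ω : Type*} (P : Fin n → Setoid Ω) : Setoid Ω := ⨆ i, P i

/-- `F₁` refines `F₂` within every common knowledge component. -/
def RefinesInEveryCKC {n : ℕ} {Ω : Type*} (P : Fin n → Setoid Ω) (F₁ F₂ : Setoid Ω) : Prop :=
  ∀ ω ω' : Ω, ckc P ω ω' → F₁ ω ω' → F₂ ω ω'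

/-- `(x 0, y 0, x 1, y 1, …, x (m-1), y (m-1))` is an `F`-loop. The index `j + 1` is taken
modulo `m`. -/
structure IsLoop {n : ℕ} {Ω : Type*} (P : Fin n → Setoid Ω) (F : Setoid Ω)
    (m : ℕ) [NeZero m] (x y : Fin m → Ω) : Prop where
  two_le : 2 ≤ m
  same_ckc : ∀ j, ckc P (x j) (y j)
  ne : ∀ j, x j ≠ y j
  link : ∀ j, F (y j) (x (j + 1))
  change_ckc : ∀ j, ¬ ckc P (x j) (x (j + 1))
  disjoint : ∀ j l, j ≠ l → Disjoint ({y j, x (j + 1)} : Set Ω) {y l, x (l + 1)}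

/-- There is an `F`-loop. -/
def HasLoop {n : ℕ} {Ω : Type*} (P : Fin n → Setoid Ω) (F : Setoid Ω) : Prop :=
  ∃ (m : ℕ) (_ : NeZero m) (x y : Fin m → Ω), IsLoop P F m x y

/-- The action sets and utilities of a Bayesian game with `n` players and state space `Ω`. -/
structure Game (n : ℕ) (Ω : Type*) where
  A : Fin n → Type
  [fintypeA : ∀ i, Fintype (A i)]
  [nonemptyA : ∀ i, Nonempty (A i)]
  u : Fin n → Ω → (∀ i, A i) → ℝ

attribute [instance] Game.fintypeA Game.nonemptyA

/-- A signaling strategy of an oracle with partition `F`: each atom of `F` is mapped to a finitely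
supported probability distribution on `S`. -/
structure Signaling {Ω : Type*} (F : Setoid Ω) (S : Type*) where
  toFun : Quotient F → S →₀ ℝ
  nonneg : ∀ c s, 0 ≤ toFun c s
  sum_eq_one : ∀ c, ((toFun c).sum fun _ p => p) = 1

/-- The distribution `τ(· ∣ ω)` of the signal in state `ω`. -/
def Signaling.at {Ω S : Type*} {F : Setoid Ω} (τ : Signaling F S) (ω : Ω) : S →₀ ℝ :=
  τ.toFun (Quotient.mk F ω)

section Model

variable {n : ℕ} {Ω : Type*} [Fintype Ω] (P : Fin n → Setoid Ω) (μ : Ω → ℝ)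
  {S : Type*} {F : Setoid Ω} (τ : Signaling F S)

open Classical in
/-- The posterior probability of `ω'` for player `i`, who has observed the atom of `ω` in `P i` and
the signal `s`; meaningful when `τ(s ∣ ω) > 0`. -/
def posterior (i : Fin n) (ω : Ω) (s : S) (ω' : Ω) : ℝ :=
  if P i ω ω' then
    μ ω' * τ.at ω' s / ∑ ω'' with P i ω ω'', μ ω'' * τ.at ω'' s
  else 0

/-- On the common knowledge component of `ω`, the signals `s` and `t` induce the same profile of
posteriors: they are possible in the same states, and in each such state every player has the same
posterior after `s` as after `t`. -/
def SamePosteriors (ω : Ω) (s t : S) : Prop :=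
  ∀ ω', ckc P ω ω' → ((0 < τ.at ω' s ↔ 0 < τ.at ω' t) ∧
    (0 < τ.at ω' s → ∀ i, posterior P μ τ i ω' s = posterior P μ τ i ω' t))

variable (G : Game n Ω)

/-- Functions assigning to each player a (not yet normalized) strategy `Π_i × S → (A_i → ℝ)`. -/
abbrev Profile (S : Type*) :=
  ∀ i : Fin n, Quotient (P i) → S → G.A i → ℝ

/-- A profile of behavioural strategies `σ_i : Π_i × S → Δ(A_i)` that depend on the signal only
through the profile of posteriors that it induces. -/
structure IsStrategyProfile (σ : Profile P G S) : Prop where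
  mem_simplex : ∀ i c s, σ i c s ∈ stdSimplex ℝ (G.A i)
  posterior_based : ∀ i ω s t, SamePosteriors P μ τ ω s t →
    σ i (Quotient.mk (P i) ω) s = σ i (Quotient.mk (P i) ω) t

/-- Expected payoff of player `i` in state `ω` when each player `j` independently uses the mixed
action `x j`. -/
def mixedPayoff (i : Fin n) (ω : Ω) (x : ∀ j, G.A j → ℝ) : ℝ :=
  ∑ a : (∀ j, G.A j), (∏ j, x j (a j)) * G.u i ω a

/-- Expected payoff of player `i`, at the information given by `ω` and `s`, from the mixed action
`ρ` against the strategies `σ` of the other players. -/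
def interimPayoff (σ : Profile P G S) (i : Fin n) (ω : Ω) (s : S) (ρ : G.A i → ℝ) : ℝ :=
  ∑ ω', posterior P μ τ i ω s ω' *
    mixedPayoff G i ω' (Function.update (fun j => σ j (Quotient.mk (P j) ω') s) i ρ)

/-- Nash equilibrium of the incomplete-information game `G(τ)`: at every information that has
positive probability, every player's mixed action is a best response among all mixed actions. -/
structure IsNash (σ : Profile P G S) : Prop where
  isStrategyProfile : IsStrategyProfile P μ τ G σ
  best_response : ∀ i ω s, 0 < μ ω → 0 < τ.at ω s → ∀ ρ ∈ stdSimplex ℝ (G.A i),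
    interimPayoff P μ τ G σ i ω s ρ ≤
      interimPayoff P μ τ G σ i ω s (σ i (Quotient.mk (P i) ω) s)

/-- The probability of the state `ω` and the action profile `a`. -/
def outcome (σ : Profile P G S) (ω : Ω) (a : ∀ i, G.A i) : ℝ :=
  μ ω * (τ.at ω).sum fun s p => p * ∏ i, σ i (Quotient.mk (P i) ω) s (a i)

/-- The set of distributions on `Ω × A` induced by the Nash equilibria of `G(τ)`. -/
def NED : Set (Ω → (∀ i, G.A i) → ℝ) :=
  {d | ∃ σ : Profile P G S, IsNash P μ τ G σ ∧ d = outcome P μ τ G σ}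

end Model

/-- The oracle with partition `F₁` dominates the oracle with partition `F₂`. -/
def Dominates {n : ℕ} {Ω : Type*} [Fintype Ω] (P : Fin n → Setoid Ω) (μ : Ω → ℝ) (S : Type*)
    (F₁ F₂ : Setoid Ω) : Prop :=
  ∀ (τ₂ : Signaling F₂ S) (G : Game n Ω), ∃ τ₁ : Signaling F₁ S,
    NED P μ τ₁ G = NED P μ τ₂ G

end

end GuidedGame

/-! Refinement within every component suffices when there are no loops. Equilibrium play in a common
knowledge component depends on the signal only through the posteriors held there, so `τ₁` and `τ₂`
have the same equilibrium distributions if, within each component separately, `τ₁` arises from `τ₂`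
by splitting signals proportionally (`Relabels.NED_eq`). Within one component `τ₂` is measurable
with respect to `F₁`, and the difficulty is that an atom of `F₁` may meet several components. Let
`τ₁` send a family of signals, one for each component `D`, drawn independently: on an atom that
meets `D`, the `D`-coordinate is drawn as `τ₂` does on the states of `D` in this atom, and on
other atoms as on a representative atom meeting `D`. Inside a component `C` this is a relabelling
of `τ₂` provided that all the atoms meeting `C` have the same representative in every `D ≠ C`. Such
representatives exist unless two different atoms meeting `D` are linked through components other
than `D`, and a shortest link of this kind closes up to a loop (`hasLoop_of_reachable`,
`exists_representatives`, `exists_relabels`).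

Refinement is necessary, with or without loops. Suppose that `ω₀` and `ω` lie in one component and
in one atom of `F₁`, but not in one atom of `F₂`. Let `τ₂` announce `s` with probability `1` on the
`F₂`-atom of `ω₀` and `1 / 2` elsewhere. In the game of `IsBettingGame`, players stay out or enter
with a bet that is fair given `s`; entering pays only if all do so. Entering after `s` in this
component with the bet that pays nothing, and staying out otherwise, is an equilibrium
(`isNash_enterProfile`). If its outcome also arises from some `τ₁`, then after some signal `r`
possible in `ω₀` all players enter; they must find all bets fair, which spreads along the partitions
to the whole component and makes `τ₁(r ∣ ·)` proportional there to `τ₂(s ∣ ·)`. So `r` is twice as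
likely in `ω₀` as in `ω`, whereas `τ₁` agrees on these states (`not_rel_of_mem_NED`). -/

namespace GuidedGame

/-! ### Relabelling signals within each common knowledge component -/

lemma Signaling.at_nonneg {Ω S : Type*} {F : Setoid Ω} (τ : Signaling F S) (ω : Ω) (s : S) :
    0 ≤ τ.at ω s := τ.nonneg _ _

lemma Signaling.sum_at {Ω S : Type*} {F : Setoid Ω} (τ : Signaling F S) (ω : Ω) :
    ((τ.at ω).sum fun _ p => p) = 1 :=
  τ.sum_eq_one _

lemma exists_mem_stdSimplex (α : Type*) [Fintype α] [Nonempty α] : ∃ x, x ∈ stdSimplex ℝ α := by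
  classical
  exact ⟨_, single_mem_stdSimplex ℝ (Classical.arbitrary α)⟩

section Relabel

variable {n : ℕ} {Ω S : Type*} {P : Fin n → Setoid Ω} {μ : Ω → ℝ}
  {F F₁ F₂ : Setoid Ω}

/-- The common knowledge component that contains a given atom of `P i`. -/
def ckcOf (P : Fin n → Setoid Ω) (i : Fin n) : Quotient (P i) → Quotient (ckc P) :=
  Quotient.map' id fun _ _ h => (le_iSup P i) h

/-- The signal `s` has positive probability in some state of the common knowledge component `C`. -/
def Possible (P : Fin n → Setoid Ω) (τ : Signaling F S) (C : Quotient (ckc P)) (s : S) : Prop :=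
  ∃ ω, Quotient.mk (ckc P) ω = C ∧ 0 < τ.at ω s

/-- In each common knowledge component `C`, the signaling strategy `τ₁` is `τ₂` up to splitting
signals: the signal `t` of `τ₁` stands for the signal `φ C t` of `τ₂`, of which it takes the share
`κ C t` in every state of `C`. -/
structure Relabels (P : Fin n → Setoid Ω) (τ₁ : Signaling F₁ S) (τ₂ : Signaling F₂ S)
    (φ : Quotient (ckc P) → S → S) (κ : Quotient (ckc P) → S → ℝ) : Prop where
  mapDomain_eq : ∀ ω, (τ₁.at ω).mapDomain (φ (Quotient.mk (ckc P) ω)) = τ₂.at ω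
  eq_mul : ∀ ω t, τ₁.at ω t =
    κ (Quotient.mk (ckc P) ω) t * τ₂.at ω (φ (Quotient.mk (ckc P) ω) t)

namespace Relabels

variable {τ₁ : Signaling F₁ S} {τ₂ : Signaling F₂ S} {φ : Quotient (ckc P) → S → S}
  {κ : Quotient (ckc P) → S → ℝ}

lemma share_pos (h : Relabels P τ₁ τ₂ φ κ) {C : Quotient (ckc P)} {t : S}
    (ht : Possible P τ₁ C t) : 0 < κ C t := by
  obtain ⟨ω, rfl, hω⟩ := ht
  rw [h.eq_mul] at hω
  exact pos_of_mul_pos_left hω (τ₂.at_nonneg _ _)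

lemma at_pos_iff (h : Relabels P τ₁ τ₂ φ κ) {ω : Ω} {t : S}
    (ht : Possible P τ₁ (Quotient.mk _ ω) t) :
    0 < τ₁.at ω t ↔ 0 < τ₂.at ω (φ (Quotient.mk _ ω) t) := by
  rw [h.eq_mul]
  exact mul_pos_iff_of_pos_left (h.share_pos ht)

lemma exists_of_pos (h : Relabels P τ₁ τ₂ φ κ) {ω : Ω} {s : S} (hs : 0 < τ₂.at ω s) :
    ∃ t, 0 < τ₁.at ω t ∧ φ (Quotient.mk _ ω) t = s := by
  classical
  have : s ∈ ((τ₁.at ω).mapDomain (φ (Quotient.mk _ ω))).support := by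
    rw [h.mapDomain_eq]; exact Finsupp.mem_support_iff.2 hs.ne'
  obtain ⟨t, ht, rfl⟩ := Finset.mem_image.1 (Finsupp.mapDomain_support this)
  exact ⟨t, lt_of_le_of_ne (τ₁.at_nonneg _ _) (Ne.symm (Finsupp.mem_support_iff.1 ht)), rfl⟩

variable {G : Game n Ω}

/-- The profiles `σ₁` and `σ₂` prescribe the same behaviour after a signal and after the signal for
which it stands. -/
def Agree (P : Fin n → Setoid Ω) (τ₁ : Signaling F₁ S) (φ : Quotient (ckc P) → S → S)
    (σ₁ σ₂ : Profile P G S) : Prop :=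
  ∀ ω t, Possible P τ₁ (Quotient.mk _ ω) t → ∀ j,
    σ₁ j (Quotient.mk _ ω) t = σ₂ j (Quotient.mk _ ω) (φ (Quotient.mk _ ω) t)

lemma outcome_eq (h : Relabels P τ₁ τ₂ φ κ) {σ₁ σ₂ : Profile P G S}
    (hσ : Agree P τ₁ φ σ₁ σ₂) : outcome P μ τ₁ G σ₁ = outcome P μ τ₂ G σ₂ := by
  funext ω a
  unfold outcome
  congr 1
  rw [← h.mapDomain_eq ω, Finsupp.sum_mapDomain_index (by simp) (by intros; ring)]
  refine Finsupp.sum_congr fun t ht => ?_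
  have : Possible P τ₁ (Quotient.mk _ ω) t :=
    ⟨ω, rfl, lt_of_le_of_ne (τ₁.at_nonneg _ _) (Ne.symm (Finsupp.mem_support_iff.1 ht))⟩
  simp only [hσ ω t this]

variable [Fintype Ω]

lemma _root_.GuidedGame.SamePosteriors.possible_iff {τ : Signaling F S} {ω : Ω} {s t : S}
    (h : SamePosteriors P μ τ ω s t) :
    Possible P τ (Quotient.mk _ ω) s ↔ Possible P τ (Quotient.mk _ ω) t := by
  constructor
  · rintro ⟨ω', h1, h2⟩
    exact ⟨ω', h1, (h ω' (Quotient.exact h1.symm)).1.1 h2⟩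
  · rintro ⟨ω', h1, h2⟩
    exact ⟨ω', h1, (h ω' (Quotient.exact h1.symm)).1.2 h2⟩

lemma posterior_eq (h : Relabels P τ₁ τ₂ φ κ) {ω : Ω} {t : S}
    (ht : Possible P τ₁ (Quotient.mk _ ω) t) (i : Fin n) :
    posterior P μ τ₁ i ω t = posterior P μ τ₂ i ω (φ (Quotient.mk _ ω) t) := by
  classical
  have hk := (h.share_pos ht).ne'
  have key : ∀ ω', P i ω ω' → μ ω' * τ₁.at ω' t =
      κ (Quotient.mk _ ω) t * (μ ω' * τ₂.at ω' (φ (Quotient.mk _ ω) t)) := by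
    intro ω' hω'
    have : (Quotient.mk (ckc P) ω') = Quotient.mk _ ω :=
      Quotient.sound ((le_iSup P i) (Setoid.symm' _ hω'))
    rw [h.eq_mul ω', this]; ring
  funext ω'
  unfold posterior
  split_ifs with hω'
  · rw [key ω' hω', Finset.sum_congr rfl fun z hz => key z (by simpa using hz),
      ← Finset.mul_sum, mul_div_mul_left _ _ hk]
  · rfl

lemma samePosteriors_iff (h : Relabels P τ₁ τ₂ φ κ) {ω : Ω} {t t' : S}
    (ht : Possible P τ₁ (Quotient.mk _ ω) t) (ht' : Possible P τ₁ (Quotient.mk _ ω) t') :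
    SamePosteriors P μ τ₁ ω t t' ↔ SamePosteriors P μ τ₂ ω (φ (Quotient.mk _ ω) t)
      (φ (Quotient.mk _ ω) t') := by
  refine forall_congr' fun ω' => forall_congr' fun hω' => ?_
  have hc : Quotient.mk (ckc P) ω = Quotient.mk _ ω' := Quotient.sound hω'
  rw [hc] at ht ht' ⊢
  simp only [h.at_pos_iff ht, h.at_pos_iff ht', h.posterior_eq ht, h.posterior_eq ht']

lemma interimPayoff_eq (h : Relabels P τ₁ τ₂ φ κ) {σ₁ σ₂ : Profile P G S}
    (hσ : Agree P τ₁ φ σ₁ σ₂) {ω : Ω} {t : S} (ht : Possible P τ₁ (Quotient.mk _ ω) t)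
    (i : Fin n) (ρ : G.A i → ℝ) :
    interimPayoff P μ τ₁ G σ₁ i ω t ρ =
      interimPayoff P μ τ₂ G σ₂ i ω (φ (Quotient.mk _ ω) t) ρ := by
  unfold interimPayoff
  refine Finset.sum_congr rfl fun ω' _ => ?_
  rw [h.posterior_eq ht]
  by_cases hω' : P i ω ω'
  · have hc : Quotient.mk (ckc P) ω = Quotient.mk _ ω' := Quotient.sound ((le_iSup P i) hω')
    rw [hc] at ht ⊢
    simp only [hσ ω' t ht]
  · simp [posterior, hω']

lemma NED_subset_of_right (h : Relabels P τ₁ τ₂ φ κ) : NED P μ τ₂ G ⊆ NED P μ τ₁ G := by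
  classical
  rintro _ ⟨σ₂, hσ₂, rfl⟩
  choose d hd using fun i => exists_mem_stdSimplex (G.A i)
  let σ₁ : Profile P G S := fun i c t =>
    if Possible P τ₁ (ckcOf P i c) t then σ₂ i c (φ (ckcOf P i c) t) else d i
  have hag : Agree P τ₁ φ σ₁ σ₂ := fun ω t ht j => if_pos ht
  refine ⟨σ₁, ⟨⟨?_, ?_⟩, ?_⟩, (h.outcome_eq hag).symm⟩
  · intro i c t
    simp only [σ₁]
    split_ifs
    exacts [hσ₂.1.1 _ _ _, hd i]
  · intro i ω s t hst
    by_cases hs : Possible P τ₁ (Quotient.mk _ ω) s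
    · have ht := hst.possible_iff.1 hs
      rw [hag ω s hs, hag ω t ht]
      exact hσ₂.1.2 _ _ _ _ ((h.samePosteriors_iff hs ht).1 hst)
    · have ht := mt hst.possible_iff.2 hs
      exact (if_neg hs).trans (if_neg ht).symm
  · intro i ω t hμ ht ρ hρ
    have hp : Possible P τ₁ (Quotient.mk _ ω) t := ⟨ω, rfl, ht⟩
    rw [h.interimPayoff_eq hag hp, h.interimPayoff_eq hag hp, hag ω t hp]
    exact hσ₂.2 i ω _ hμ ((h.at_pos_iff hp).1 ht) ρ hρ

lemma NED_subset_of_left (h : Relabels P τ₁ τ₂ φ κ) : NED P μ τ₁ G ⊆ NED P μ τ₂ G := by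
  classical
  rintro _ ⟨σ₁, hσ₁, rfl⟩
  choose d hd using fun i => exists_mem_stdSimplex (G.A i)
  let σ₂ : Profile P G S := fun i c s =>
    if hs : ∃ t, Possible P τ₁ (ckcOf P i c) t ∧ φ (ckcOf P i c) t = s then σ₁ i c hs.choose
    else d i
  have hag : Agree P τ₁ φ σ₁ σ₂ := by
    intro ω t ht j
    have hs : ∃ t', Possible P τ₁ (Quotient.mk _ ω) t' ∧
        φ (Quotient.mk _ ω) t' = φ (Quotient.mk _ ω) t := ⟨t, ht, rfl⟩
    refine Eq.trans ?_ (dif_pos hs).symm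
    refine hσ₁.1.2 j ω _ _ ((h.samePosteriors_iff ht hs.choose_spec.1).2 ?_)
    rw [hs.choose_spec.2]
    exact fun _ _ => ⟨Iff.rfl, fun _ _ => rfl⟩
  -- Every signal that `τ₂` sends in a component is represented by a signal of `τ₁`.
  have hrep : ∀ ω s, Possible P τ₂ (Quotient.mk _ ω) s →
      ∃ t, Possible P τ₁ (Quotient.mk _ ω) t ∧ φ (Quotient.mk _ ω) t = s := by
    rintro ω s ⟨ω', h1, h2⟩
    obtain ⟨t, ht, hts⟩ := h.exists_of_pos h2
    exact ⟨t, ⟨ω', h1, ht⟩, h1 ▸ hts⟩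
  refine ⟨σ₂, ⟨⟨?_, ?_⟩, ?_⟩, h.outcome_eq hag⟩
  · intro i c s
    simp only [σ₂]
    split_ifs
    exacts [hσ₁.1.1 _ _ _, hd i]
  · intro i ω s s' hst
    by_cases hs : Possible P τ₂ (Quotient.mk _ ω) s
    · obtain ⟨t, ht, rfl⟩ := hrep ω s hs
      obtain ⟨t', ht', rfl⟩ := hrep ω s' (hst.possible_iff.1 hs)
      rw [← hag ω t ht, ← hag ω t' ht']
      exact hσ₁.1.2 _ _ _ _ ((h.samePosteriors_iff ht ht').2 hst)
    · have key : ∀ r, ¬ Possible P τ₂ (Quotient.mk _ ω) r → σ₂ i (Quotient.mk _ ω) r = d i := by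
        intro r hr
        refine dif_neg ?_
        rintro ⟨t, ⟨ω', h1, h2⟩, rfl⟩
        have h1' : Quotient.mk (ckc P) ω' = Quotient.mk _ ω := h1
        refine hr ⟨ω', h1', ?_⟩
        have := (h.at_pos_iff ⟨ω', rfl, h2⟩).1 h2
        rw [h1'] at this
        exact this
      rw [key s hs, key s' (mt hst.possible_iff.2 hs)]
  · intro i ω s hμ hs ρ hρ
    obtain ⟨t, ht, rfl⟩ := h.exists_of_pos hs
    have hp : Possible P τ₁ (Quotient.mk _ ω) t := ⟨ω, rfl, ht⟩
    rw [← h.interimPayoff_eq hag hp, ← h.interimPayoff_eq hag hp, ← hag ω t hp]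
    exact hσ₁.2 i ω _ hμ ht ρ hρ

/-- Equilibrium play in a component depends on the signal only through the posteriors held in that
component, and these are unchanged when signals are split proportionally. -/
theorem NED_eq (h : Relabels P τ₁ τ₂ φ κ) : NED P μ τ₁ G = NED P μ τ₂ G :=
  h.NED_subset_of_left.antisymm h.NED_subset_of_right

end Relabels

end Relabel

/-! ### Loops and atoms linked outside a common knowledge component -/

section Loops

variable {n : ℕ} {Ω : Type*} {P : Fin n → Setoid Ω} {F : Setoid Ω}

/-- The graph on the atoms of `F` in which two atoms are adjacent when some common knowledge
component other than `C` meets both of them. -/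
def bypassGraph (P : Fin n → Setoid Ω) (F : Setoid Ω) (C : Quotient (ckc P)) :
    SimpleGraph (Quotient F) where
  Adj f g := f ≠ g ∧ ∃ a b : Ω, Quotient.mk F a = f ∧ Quotient.mk F b = g ∧ ckc P a b ∧
    Quotient.mk (ckc P) a ≠ C
  symm := ⟨by
    rintro f g ⟨hne, a, b, ha, hb, hab, haC⟩
    exact ⟨hne.symm, b, a, hb, ha, Setoid.symm' _ hab, fun h => haC ((Quotient.sound hab).trans h)⟩⟩
  loopless := ⟨fun _ h => h.1 rfl⟩

/-- Two different atoms of `F` that meet `C` and are linked by components other than `C` yield a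
loop: a shortest such link is closed up through `C`. -/
lemma hasLoop_of_reachable {ω ω' : Ω} (hC : ckc P ω ω')
    (hr : (bypassGraph P F (Quotient.mk _ ω)).Reachable (Quotient.mk F ω) (Quotient.mk F ω'))
    (hne : ¬ F ω ω') : HasLoop P F := by
  obtain ⟨p, hp, hlen⟩ := hr.exists_path_of_dist
  generalize hk : p.length = k at hlen
  cases k with
  | zero =>
    exact absurd (Quotient.exact (SimpleGraph.Walk.eq_of_length_eq_zero hk)) hne
  | succ k =>
    have hadj : ∀ j : Fin (k + 1), (bypassGraph P F (Quotient.mk _ ω)).Adj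
        (p.getVert j) (p.getVert (j + 1)) := fun j => p.adj_getVert_succ (by omega)
    choose hv a b ha hb hab haC using hadj
    -- The states of the loop in its `j`-th component; the component of index `0` is that of `ω`.
    let x : Fin (k + 1 + 1) → Ω := Fin.cons ω' a
    let y : Fin (k + 1 + 1) → Ω := Fin.cons ω b
    have hxy : ∀ j, ckc P (x j) (y j) := by
      intro j
      refine Fin.cases ?_ (fun i => ?_) j
      · exact Setoid.symm' _ hC
      · exact hab i
    have hy : ∀ j, Quotient.mk F (y j) = p.getVert j := by
      intro j
      refine Fin.cases ?_ (fun i => ?_) j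
      · simp [y]
      · simp [y, hb]
    have hx : ∀ j, Quotient.mk F (x (j + 1)) = p.getVert j := by
      intro j
      refine Fin.lastCases ?_ (fun i => ?_) j
      · rw [Fin.last_add_one]
        simp [x, ← hk]
      · rw [Fin.coeSucc_eq_succ]
        simp [x, ha]
    have hinj : ∀ j l : Fin (k + 1 + 1), p.getVert j = p.getVert l → j = l := by
      intro j l h
      exact Fin.ext (hp.getVert_injOn (by simp; omega) (by simp; omega) h)
    refine ⟨k + 1 + 1, inferInstance, x, y, ⟨by omega, hxy, ?_, ?_, ?_, ?_⟩⟩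
    · intro j hj
      refine Fin.cases (fun hj => ?_) (fun i hj => ?_) j hj
      · have hj' : ω' = ω := hj
        exact hne (hj' ▸ Setoid.refl' _ _)
      · have hj' : a i = b i := hj
        exact hv i (by rw [← ha, ← hb, hj'])
    · intro j
      exact Quotient.exact ((hy j).trans (hx j).symm)
    · intro j hj
      have hj := Setoid.trans' _ (Setoid.symm' _ (hxy j)) hj
      refine Fin.lastCases (fun hj => ?_) (fun i hj => ?_) j hj
      · rw [Fin.last_add_one] at hj
        have h1 : ckc P (b (Fin.last k)) ω' := by
          rwa [← Fin.succ_last] at hj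
        refine haC (Fin.last k) (Quotient.sound ?_)
        exact Setoid.trans' _ (hab _) (Setoid.trans' _ h1 (Setoid.symm' _ hC))
      · rw [Fin.coeSucc_eq_succ] at hj
        have hj' : ckc P (y i.castSucc) (a i) := hj
        clear hj
        rcases i with ⟨i, hi⟩
        cases i with
        | zero => exact haC _ (Quotient.sound (Setoid.symm' _ hj'))
        | succ i =>
          -- Two consecutive components coincide, so the link can be shortened.
          have hj'' : ckc P (b ⟨i, by omega⟩) (a ⟨i + 1, hi⟩) := hj'
          have h0 : (bypassGraph P F (Quotient.mk _ ω)).Adj (p.getVert i) (p.getVert (i + 2)) := by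
            refine ⟨fun h => ?_, a ⟨i, by omega⟩, b ⟨i + 1, hi⟩, ha _, hb _, ?_, haC _⟩
            · have := hp.getVert_injOn (by simp; omega) (by simp; omega) h
              omega
            · exact Setoid.trans' _ (hab _) (Setoid.trans' _ hj'' (hab _))
          have := SimpleGraph.dist_le ((p.take i).append (.cons h0 (p.drop (i + 2))))
          simp [SimpleGraph.Walk.take_length, SimpleGraph.Walk.drop_length] at this
          omega
    · intro j l hjl
      rw [Set.disjoint_left]
      intro z hz hz'
      have h1 : Quotient.mk F z = p.getVert j := by
        rcases hz with rfl | rfl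
        exacts [hy j, hx j]
      have h2 : Quotient.mk F z = p.getVert l := by
        rcases hz' with rfl | rfl
        exacts [hy l, hx l]
      exact hjl (hinj j l (h1.symm.trans h2))

/-- Without loops, each component `C` admits a choice, for every atom of `F`, of a state such that
the atoms meeting `C` are represented by states of `C` in them, while any two atoms that meet a
common other component have the same representative. -/
lemma exists_representatives (h : ¬ HasLoop P F) (C : Quotient (ckc P)) :
    ∃ ψ : Quotient F → Ω,
      (∀ ω, Quotient.mk _ ω = C → Quotient.mk _ (ψ (Quotient.mk _ ω)) = C ∧
        F ω (ψ (Quotient.mk _ ω))) ∧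
      ∀ ω ω', ckc P ω ω' → Quotient.mk _ ω ≠ C →
        ψ (Quotient.mk _ ω) = ψ (Quotient.mk _ ω') := by
  let Q : Quotient F → Ω → Prop := fun f z =>
    Quotient.mk _ z = C ∧ (bypassGraph P F C).Reachable f (Quotient.mk F z)
  have : Nonempty Ω := ⟨C.out⟩
  refine ⟨fun f => Classical.epsilon (Q f), ?_, ?_⟩
  · rintro ω rfl
    have hs := Classical.epsilon_spec (p := Q (Quotient.mk F ω)) ⟨ω, rfl, .rfl⟩
    refine ⟨hs.1, ?_⟩
    by_contra hne
    exact h (hasLoop_of_reachable (Quotient.exact hs.1.symm) hs.2 hne)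
  · intro ω ω' hωω' hωC
    have hr : (bypassGraph P F C).Reachable (Quotient.mk F ω) (Quotient.mk F ω') := by
      by_cases he : Quotient.mk F ω = Quotient.mk F ω'
      · rw [he]
      · exact SimpleGraph.Adj.reachable ⟨he, ω, ω', rfl, rfl, hωω', hωC⟩
    have : Q (Quotient.mk F ω) = Q (Quotient.mk F ω') := by
      funext z
      exact propext (and_congr_right fun _ => ⟨hr.symm.trans, hr.trans⟩)
    simp only [this]

end Loops

/-! ### Products of finitely supported distributions -/

section Product

variable {K S : Type*} [Fintype K]

open Classical in
/-- The product of a finite family of finitely supported functions, as a function on families of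
signals. -/
noncomputable def piFinsupp (p : K → S →₀ ℝ) : (K → S) →₀ ℝ :=
  Finsupp.onFinset (Fintype.piFinset fun D => (p D).support) (fun s => ∏ D, p D (s D))
    fun _ hs => Fintype.mem_piFinset.2 fun D =>
      Finsupp.mem_support_iff.2 (Finset.prod_ne_zero_iff.1 hs D (Finset.mem_univ D))

lemma piFinsupp_apply (p : K → S →₀ ℝ) (s : K → S) : piFinsupp p s = ∏ D, p D (s D) := rfl

lemma sum_piFinsupp_mul (p : K → S →₀ ℝ) (q : K → S → ℝ) :
    ((piFinsupp p).sum fun s r => r * ∏ D, q D (s D)) =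
      ∏ D, (p D).sum fun t r => r * q D t := by
  classical
  rw [piFinsupp, Finsupp.onFinset_sum _ (by simp)]
  simp only [Finsupp.sum, ← Finset.prod_mul_distrib]
  rw [Finset.prod_univ_sum]

lemma sum_piFinsupp (p : K → S →₀ ℝ) (hp : ∀ D, ((p D).sum fun _ r => r) = 1) :
    ((piFinsupp p).sum fun _ r => r) = 1 := by
  simpa [hp] using sum_piFinsupp_mul p fun _ _ => 1

lemma mapDomain_eval_piFinsupp (p : K → S →₀ ℝ) (hp : ∀ D, ((p D).sum fun _ r => r) = 1) (C : K) :
    (piFinsupp p).mapDomain (fun s => s C) = p C := by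
  classical
  ext t
  have h := sum_piFinsupp_mul p fun D r => if D = C then (if r = t then 1 else 0) else 1
  rw [Finset.prod_eq_single C (fun D _ hD => by simpa [hD] using hp D) (by simp)] at h
  have h1 : ∀ s : K → S, (∏ D, if D = C then (if s D = t then (1 : ℝ) else 0) else 1) =
      if s C = t then 1 else 0 := by
    intro s
    rw [Finset.prod_eq_single C (fun D _ hD => by simp [hD]) (by simp)]
    simp
  simp only [h1, if_true] at h
  rw [Finsupp.mapDomain, Finsupp.sum_apply]
  simp only [Finsupp.single_apply]
  refine Eq.trans (by simp [Finsupp.sum]) (h.trans ?_)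
  by_cases ht : p C t = 0 <;> simp [Finsupp.sum, ht]

end Product

/-! ### Sufficiency of refinement -/

section Sufficiency

variable {n : ℕ} {Ω S : Type*} [Fintype Ω] {P : Fin n → Setoid Ω} {F₁ F₂ : Setoid Ω}

/-- Oracle 1 draws, independently over the components, the signal that Oracle 2 would send in each
of them. In the component `C` only the `C`-coordinate depends on the state, by the choice of
representatives, and this coordinate is distributed as the signal of Oracle 2. -/
lemma exists_relabels [Countable S] [Infinite S] (hloop : ¬ HasLoop P F₁)
    (href : RefinesInEveryCKC P F₁ F₂) (τ₂ : Signaling F₂ S) :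
    ∃ (τ₁ : Signaling F₁ S) (φ : Quotient (ckc P) → S → S) (κ : Quotient (ckc P) → S → ℝ),
      Relabels P τ₁ τ₂ φ κ := by
  classical
  obtain ⟨e, he⟩ : ∃ e : (Quotient (ckc P) → S) → S, Function.Injective e := by
    obtain ⟨f, hf⟩ := Countable.exists_injective_nat (Quotient (ckc P) → S)
    exact ⟨_, (Infinite.natEmbedding S).injective.comp hf⟩
  choose ψ hψ hψ' using exists_representatives hloop
  let p : Quotient F₁ → Quotient (ckc P) → S →₀ ℝ := fun f D => τ₂.at (ψ D f)
  have hp : ∀ f D, ((p f D).sum fun _ r => r) = 1 := fun f D => τ₂.sum_at _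
  have hpC : ∀ ω, p (Quotient.mk _ ω) (Quotient.mk _ ω) = τ₂.at ω := by
    intro ω
    obtain ⟨h1, h2⟩ := hψ _ ω rfl
    exact congrArg τ₂.toFun (Quotient.sound
      (Setoid.symm' _ (href _ _ (Quotient.exact h1.symm) h2)))
  let τ₁ : Signaling F₁ S :=
    { toFun := fun f => (piFinsupp (p f)).mapDomain e
      nonneg := by
        intro f s
        by_cases hs : s ∈ Set.range e
        · obtain ⟨s, rfl⟩ := hs
          rw [Finsupp.mapDomain_apply he, piFinsupp_apply]
          exact Finset.prod_nonneg fun D _ => τ₂.at_nonneg _ _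
        · rw [Finsupp.mapDomain_of_notMem_range _ _ hs]
      sum_eq_one := by
        intro f
        rw [Finsupp.sum_mapDomain_index (by simp) (by simp)]
        exact sum_piFinsupp _ (hp f) }
  have : Nonempty (Quotient (ckc P) → S) := inferInstance
  have hg := Function.leftInverse_invFun he
  refine ⟨τ₁, fun C t => Function.invFun e t C, fun C t => if t ∈ Set.range e then
    ∏ D ∈ Finset.univ.erase C, p (Quotient.mk _ C.out) D (Function.invFun e t D) else 0, ?_, ?_⟩
  · intro ω
    rw [← hpC ω, ← mapDomain_eval_piFinsupp _ (hp (Quotient.mk _ ω))]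
    change Finsupp.mapDomain _ (Finsupp.mapDomain e _) = _
    rw [← Finsupp.mapDomain_comp]
    congr 1
    funext s
    simp [hg s]
  · intro ω t
    by_cases ht : t ∈ Set.range e
    · rw [if_pos ht]
      obtain ⟨s, rfl⟩ := ht
      change Finsupp.mapDomain e _ _ = _
      rw [Finsupp.mapDomain_apply he, piFinsupp_apply, hg s,
        ← Finset.prod_erase_mul _ _ (Finset.mem_univ (Quotient.mk (ckc P) ω)), hpC]
      congr 1
      refine Finset.prod_congr rfl fun D hD => ?_
      have : ψ D (Quotient.mk F₁ ω) = ψ D (Quotient.mk F₁ (Quotient.mk (ckc P) ω).out) :=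
        hψ' D _ _ (Setoid.symm' _ (Quotient.mk_out (s := ckc P) ω)) (Finset.ne_of_mem_erase hD).symm
      simp only [p, this]
    · rw [if_neg ht, zero_mul]
      exact Finsupp.mapDomain_of_notMem_range _ _ ht

theorem dominates_of_refinesInEveryCKC [Countable S] [Infinite S] {μ : Ω → ℝ}
    (hloop : ¬ HasLoop P F₁) (href : RefinesInEveryCKC P F₁ F₂) : Dominates P μ S F₁ F₂ := by
  intro τ₂ G
  obtain ⟨τ₁, φ, κ, h⟩ := exists_relabels hloop href τ₂
  exact ⟨τ₁, h.NED_eq⟩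

end Sufficiency

/-! ### Betting games -/

section Betting

/-- The payoff, in state `ω`, of a bet on `a` against `b` at odds given by the weights `w`. It is
fair for beliefs proportional to `w`. -/
noncomputable def bet {Ω : Type*} (w : Ω → ℝ) (a b ω : Ω) : ℝ := by
  classical
  exact (if ω = a then (w a)⁻¹ else 0) - (if ω = b then (w b)⁻¹ else 0)

open Classical in
/-- A game in which every player stays out or enters at the cost `M` with a bet between two states
that the player cannot distinguish. If all players enter, the cost is refunded. Thus entering is
worthwhile only jointly, and the bet `inn i`, which pays nothing, is optimal among the bets
only if all bets are fair. -/
structure IsBettingGame {n : ℕ} {Ω : Type*} (P : Fin n → Setoid Ω) (w : Ω → ℝ) (G : Game n Ω)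
    (M : ℝ) (out inn : ∀ i, G.A i) (gain : ∀ i, Ω → G.A i → ℝ) : Prop where
  utility : ∀ i ω a, G.u i ω a =
    gain i ω (a i) - (if a i = out i then 0 else M) + M * ∏ j, if a j = out j then 0 else 1
  inn_ne_out : ∀ i, inn i ≠ out i
  gain_out : ∀ i ω, gain i ω (out i) = 0
  gain_inn : ∀ i ω, gain i ω (inn i) = 0
  gain_le : ∀ i ω c, gain i ω c ≤ M
  gain_eq : ∀ i c, ∃ a b, P i a b ∧ ∀ ω, gain i ω c = bet w a b ω
  exists_gain : ∀ i a b, P i a b → ∃ c, c ≠ out i ∧ ∀ ω, gain i ω c = bet w a b ω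

lemma bet_self {Ω : Type*} (w : Ω → ℝ) (a ω : Ω) : bet w a a ω = 0 := sub_self _

lemma exists_isBettingGame {n : ℕ} {Ω : Type*} [Fintype Ω] [Nonempty Ω] (P : Fin n → Setoid Ω)
    (w : Ω → ℝ) (hw : ∀ ω, 0 < w ω) : ∃ G M out inn gain, IsBettingGame P w G M out inn gain := by
  classical
  obtain ⟨ω₀⟩ := ‹Nonempty Ω›
  -- The states are numbered because the action sets live in `Type`.
  let e := Fintype.equivFin Ω
  let N := Fintype.card Ω
  let q : Fin n → Option (Fin N × Fin N) → Ω × Ω := fun i c =>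
    c.elim (ω₀, ω₀) fun kl =>
      if P i (e.symm kl.1) (e.symm kl.2) then (e.symm kl.1, e.symm kl.2) else (ω₀, ω₀)
  have hq : ∀ i c, P i (q i c).1 (q i c).2 := by
    intro i c
    cases c with
    | none => exact Setoid.refl' _ _
    | some kl =>
      simp only [q, Option.elim]
      split_ifs with h
      exacts [h, Setoid.refl' _ _]
  let gain : Fin n → Ω → Option (Fin N × Fin N) → ℝ := fun i ω c => bet w (q i c).1 (q i c).2 ω
  let M : ℝ := ∑ ω, (w ω)⁻¹
  let G : Game n Ω :=
    { A := fun _ => Option (Fin N × Fin N)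
      u := fun i ω a =>
        gain i ω (a i) - (if a i = none then 0 else M) + M * ∏ j, if a j = none then 0 else 1 }
  refine ⟨G, M, fun _ => none, fun _ => some (e ω₀, e ω₀), gain, ⟨?_, ?_, ?_, ?_, ?_, ?_, ?_⟩⟩
  · intro i ω a
    simp only [G]
    congr!
  · intro i; exact Option.some_ne_none _
  · intro i ω; exact bet_self _ _ _
  · intro i ω
    have : q i (some (e ω₀, e ω₀)) = (ω₀, ω₀) := by simp [q]
    simp only [gain, this]
    exact bet_self _ _ _
  · intro i ω c
    have h0 : ∀ ω, 0 ≤ (w ω)⁻¹ := fun ω => (inv_pos.2 (hw ω)).le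
    have h1 := h0 (q i c).1
    have h2 := h0 (q i c).2
    have h3 : (w (q i c).1)⁻¹ ≤ M :=
      Finset.single_le_sum (f := fun ω => (w ω)⁻¹) (fun ω _ => h0 ω) (Finset.mem_univ _)
    simp only [gain, bet]
    split_ifs <;> linarith
  · intro i c
    exact ⟨_, _, hq i c, fun ω => rfl⟩
  · intro i a b hab
    refine ⟨some (e a, e b), Option.some_ne_none _, fun ω => ?_⟩
    have : q i (some (e a, e b)) = (a, b) := by simp [q, hab]
    simp only [gain, this]

variable {n : ℕ} {Ω S : Type*} {P : Fin n → Setoid Ω} {w : Ω → ℝ} {G : Game n Ω} {M : ℝ}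
  {out inn : ∀ i, G.A i} {gain : ∀ i, Ω → G.A i → ℝ}

lemma prod_update_apply [DecidableEq (Fin n)] (x : ∀ j, G.A j → ℝ) (i : Fin n) (ρ : G.A i → ℝ)
    (a : ∀ j, G.A j) :
    ∏ j, Function.update x i ρ j (a j) = ρ (a i) * ∏ j ∈ Finset.univ.erase i, x j (a j) := by
  rw [← Finset.mul_prod_erase _ _ (Finset.mem_univ i), Function.update_self]
  congr 1
  exact Finset.prod_congr rfl fun j hj => by rw [Function.update_of_ne (Finset.ne_of_mem_erase hj)]

lemma sum_prod_apply (g : ∀ j, G.A j → ℝ) :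
    ∑ a : (∀ j, G.A j), ∏ j, g j (a j) = ∏ j, ∑ c, g j c := by
  classical
  rw [Finset.prod_univ_sum, Fintype.piFinset_univ]

lemma IsBettingGame.mixedPayoff_update (h : IsBettingGame P w G M out inn gain)
    {x : ∀ j, G.A j → ℝ} (hx : ∀ j, x j ∈ stdSimplex ℝ (G.A j)) (i : Fin n) (ω : Ω)
    {ρ : G.A i → ℝ} (hρ : ρ ∈ stdSimplex ℝ (G.A i)) :
    mixedPayoff G i ω (Function.update x i ρ) = ∑ c, ρ c * gain i ω c -
      M * (1 - ρ (out i)) * (1 - ∏ j ∈ Finset.univ.erase i, (1 - x j (out j))) := by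
  classical
  have hne : ∀ j (y : G.A j → ℝ), y ∈ stdSimplex ℝ (G.A j) →
      ∑ c, y c * (if c = out j then 0 else 1) = 1 - y (out j) := by
    intro j y hy
    rw [eq_sub_iff_add_eq]
    refine Eq.trans ?_ hy.2
    rw [← Finset.sum_erase_add _ y (Finset.mem_univ (out j)),
      ← Finset.sum_erase_add _ _ (Finset.mem_univ (out j))]
    simp only [if_true, mul_zero, add_zero, add_left_inj]
    exact Finset.sum_congr rfl fun c hc => by rw [if_neg (Finset.ne_of_mem_erase hc), mul_one]
  have h1 : ∑ a : (∀ j, G.A j), (∏ j, Function.update x i ρ j (a j)) *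
      (gain i ω (a i) - (if a i = out i then 0 else M)) =
      ∑ c, ρ c * gain i ω c - M * (1 - ρ (out i)) := by
    have := sum_prod_apply (Function.update x i fun c =>
      ρ c * (gain i ω c - (if c = out i then 0 else M)))
    rw [← Finset.mul_prod_erase _ _ (Finset.mem_univ i), Function.update_self,
      Finset.prod_eq_one (s := Finset.univ.erase i), mul_one] at this
    · rw [← hne i ρ hρ, Finset.mul_sum, ← Finset.sum_sub_distrib]
      refine Eq.trans ?_ (this.trans ?_)
      · refine Finset.sum_congr rfl fun a _ => ?_
        rw [prod_update_apply, prod_update_apply]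
        ring
      · refine Finset.sum_congr rfl fun c _ => ?_
        split_ifs <;> ring
    · intro j hj
      rw [Function.update_of_ne (Finset.ne_of_mem_erase hj)]
      exact (hx j).2
  have h2 : ∑ a : (∀ j, G.A j), (∏ j, Function.update x i ρ j (a j)) *
      (M * ∏ j, if a j = out j then 0 else 1) =
      M * ((1 - ρ (out i)) * ∏ j ∈ Finset.univ.erase i, (1 - x j (out j))) := by
    have := sum_prod_apply fun j c => Function.update x i ρ j c * (if c = out j then 0 else 1)
    rw [← Finset.mul_prod_erase _ _ (Finset.mem_univ i), Function.update_self, hne i ρ hρ,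
      Finset.prod_congr (g := fun j => 1 - x j (out j)) rfl] at this
    · rw [← this, Finset.mul_sum]
      refine Finset.sum_congr rfl fun a _ => ?_
      rw [Finset.prod_mul_distrib]
      ring
    · intro j hj
      rw [Function.update_of_ne (Finset.ne_of_mem_erase hj)]
      exact hne j _ (hx j)
  unfold mixedPayoff
  simp only [h.utility, mul_add, Finset.sum_add_distrib]
  rw [h1, h2]
  ring

variable [Fintype Ω] {μ p : Ω → ℝ} {F : Setoid Ω} {τ : Signaling F S}

lemma posterior_nonneg (hμ : ∀ ω, 0 < μ ω) (i : Fin n) (ω : Ω) (s : S) (ω' : Ω) :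
    0 ≤ posterior P μ τ i ω s ω' := by
  classical
  have h : ∀ z, 0 ≤ μ z * τ.at z s := fun z => mul_nonneg (hμ z).le (τ.at_nonneg _ _)
  unfold posterior
  split_ifs
  exacts [div_nonneg (h _) (Finset.sum_nonneg fun z _ => h z), le_rfl]

open Classical in
/-- The expected payoff of a bet compares the likelihood ratios of the two states with the odds. -/
lemma sum_posterior_mul_bet (hμ : ∀ ω, 0 < μ ω) {i : Fin n} {ω a b : Ω} (s : S)
    (ha : P i ω a) (hb : P i ω b) :
    ∑ ω', posterior P μ τ i ω s ω' * bet (fun z => μ z * p z) a b ω' =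
      (τ.at a s / p a - τ.at b s / p b) / ∑ z with P i ω z, μ z * τ.at z s := by
  simp only [bet, mul_sub, Finset.sum_sub_distrib, mul_ite, mul_zero, Finset.sum_ite_eq',
    Finset.mem_univ, if_true]
  unfold posterior
  rw [if_pos ha, if_pos hb, sub_div]
  have hc : ∀ z, μ z * τ.at z s / (∑ z with P i ω z, μ z * τ.at z s) * (μ z * p z)⁻¹ =
      τ.at z s / p z / ∑ z with P i ω z, μ z * τ.at z s := by
    intro z
    rw [mul_inv, div_eq_mul_inv, div_eq_mul_inv, div_eq_mul_inv]
    have := mul_inv_cancel₀ (hμ z).ne'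
    linear_combination τ.at z s * (∑ z with P i ω z, μ z * τ.at z s)⁻¹ * (p z)⁻¹ * this
  rw [hc, hc]

lemma sum_posterior_mul_bet_eq_zero {i : Fin n} {ω a b : Ω} (s : S) (hab : P i a b)
    (ha : ¬ P i ω a) : ∑ ω', posterior P μ τ i ω s ω' * bet w a b ω' = 0 := by
  classical
  refine Finset.sum_eq_zero fun ω' _ => ?_
  by_cases h : P i ω ω'
  · have h1 : ω' ≠ a := fun e => ha (e ▸ h)
    have h2 : ω' ≠ b := fun e => ha (Setoid.trans' _ (e ▸ h) (Setoid.symm' _ hab))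
    simp [bet, h1, h2]
  · simp [posterior, h]

lemma sum_sub_add_single {α : Type*} [Fintype α] [DecidableEq α] (y f : α → ℝ) (b c : α) (r : ℝ) :
    ∑ d, (y d - (if d = b then r else 0) + (if d = c then r else 0)) * f d =
      ∑ d, y d * f d + r * (f c - f b) := by
  simp only [add_mul, sub_mul, ite_mul, zero_mul, Finset.sum_add_distrib, Finset.sum_sub_distrib,
    Finset.sum_ite_eq', Finset.mem_univ, if_true]
  ring

/-- A player who in equilibrium enters with the bet that pays nothing finds no bet profitable. -/
lemma IsBettingGame.sum_posterior_mul_bet_nonpos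
    (h : IsBettingGame P w G M out inn gain)
    {σ : Profile P G S} (hσ : IsNash P μ τ G σ) {i : Fin n} {ω a b : Ω} {s : S}
    (hμ : 0 < μ ω) (hs : 0 < τ.at ω s) (hinn : 0 < σ i (Quotient.mk _ ω) s (inn i))
    (hab : P i a b) : ∑ ω', posterior P μ τ i ω s ω' * bet w a b ω' ≤ 0 := by
  classical
  obtain ⟨c, hc, hgain⟩ := h.exists_gain i a b hab
  set y := σ i (Quotient.mk _ ω) s with hy
  have hyS : y ∈ stdSimplex ℝ (G.A i) := hσ.1.1 _ _ _
  -- The deviation moves the weight of `inn i` to `c`.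
  let ρ : G.A i → ℝ := fun d =>
    y d - (if d = inn i then y (inn i) else 0) + (if d = c then y (inn i) else 0)
  have hρ : ρ ∈ stdSimplex ℝ (G.A i) := by
    constructor
    · intro d
      have := hyS.1 d
      simp only [ρ]
      split_ifs with h1 h2 h2
      · subst h1; linarith
      · subst h1; linarith
      · linarith
      · linarith
    · have := sum_sub_add_single y (fun _ => 1) (inn i) c (y (inn i))
      simpa [ρ, hyS.2] using this
  have hout : ρ (out i) = y (out i) := by
    simp [ρ, (h.inn_ne_out i).symm, hc.symm]
  have hbr := hσ.2 i ω s hμ hs ρ hρ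
  rw [← hy] at hbr
  unfold interimPayoff at hbr
  rw [← sub_nonpos, ← Finset.sum_sub_distrib] at hbr
  have : y (inn i) * ∑ ω', posterior P μ τ i ω s ω' * bet w a b ω' ≤ 0 := by
    rw [Finset.mul_sum]
    refine le_of_eq_of_le (Finset.sum_congr rfl fun ω' _ => ?_) hbr
    rw [h.mixedPayoff_update (fun j => hσ.1.1 _ _ _) _ _ hρ,
      h.mixedPayoff_update (fun j => hσ.1.1 _ _ _) _ _ hyS, hout, sum_sub_add_single,
      h.gain_inn, hgain]
    ring
  exact nonpos_of_mul_nonpos_right this hinn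

lemma IsBettingGame.likelihood_ratio_eq
    (h : IsBettingGame P (fun z => μ z * p z) G M out inn gain)
    {σ : Profile P G S} (hσ : IsNash P μ τ G σ) (hμ : ∀ ω, 0 < μ ω) {i : Fin n} {ω ω' : Ω} {s : S}
    (hs : 0 < τ.at ω s) (hinn : 0 < σ i (Quotient.mk _ ω) s (inn i))
    (hω' : P i ω ω') : τ.at ω s / p ω = τ.at ω' s / p ω' := by
  classical
  have hZ : 0 < ∑ z with P i ω z, μ z * τ.at z s := by
    refine Finset.sum_pos' (fun z _ => mul_nonneg (hμ z).le (τ.at_nonneg _ _))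
      ⟨ω, by simp, mul_pos (hμ ω) hs⟩
  have key : ∀ a b, P i ω a → P i ω b → τ.at a s / p a ≤ τ.at b s / p b := by
    intro a b ha hb
    have := h.sum_posterior_mul_bet_nonpos hσ (hμ ω) hs hinn
      (Setoid.trans' _ (Setoid.symm' _ ha) hb)
    rw [sum_posterior_mul_bet hμ s ha hb] at this
    by_contra! hlt
    exact absurd this (not_le.2 (div_pos (sub_pos.2 hlt) hZ))
  exact (key _ _ (Setoid.refl' _ _) hω').antisymm (key _ _ hω' (Setoid.refl' _ _))

end Betting

/-! ### Necessity of refinement -/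

section Necessity

/-- The strategy of the oracle with partition `F` that announces `s` on the atom of `ω₀`, and
elsewhere announces `s` or `t` with probability `1 / 2` each. -/
noncomputable def halfReveal {Ω S : Type*} (F : Setoid Ω) (ω₀ : Ω) (s t : S) : Signaling F S := by
  classical
  exact
  { toFun := fun c => if c = Quotient.mk _ ω₀ then Finsupp.single s 1 else
      Finsupp.single s (1 / 2) + Finsupp.single t (1 / 2)
    nonneg := by
      intro c r
      split_ifs
      · rw [Finsupp.single_apply]; split_ifs <;> norm_num
      · rw [Finsupp.add_apply, Finsupp.single_apply, Finsupp.single_apply]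
        split_ifs <;> norm_num
    sum_eq_one := by
      intro c
      split_ifs
      · simp
      · rw [Finsupp.sum_add_index' (by simp) (by simp)]
        simp only [Finsupp.sum_single_index]
        norm_num }

/-- The probability of the signal `s` under `halfReveal`. -/
noncomputable def halfProb {Ω : Type*} (F : Setoid Ω) (ω₀ ω : Ω) : ℝ := by
  classical
  exact if F ω ω₀ then 1 else 1 / 2

lemma halfProb_pos {Ω : Type*} (F : Setoid Ω) (ω₀ ω : Ω) : 0 < halfProb F ω₀ ω := by
  unfold halfProb; split_ifs <;> norm_num

variable {n : ℕ} {Ω S : Type*} {P : Fin n → Setoid Ω} {F F₁ F₂ : Setoid Ω} {ω₀ : Ω} {s t : S}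

lemma halfReveal_at_of_rel {ω : Ω} (h : F ω ω₀) :
    (halfReveal F ω₀ s t).at ω = Finsupp.single s 1 :=
  if_pos (Quotient.sound h)

lemma halfReveal_at_fst (hst : s ≠ t) (ω : Ω) :
    (halfReveal F ω₀ s t).at ω s = halfProb F ω₀ ω := by
  classical
  by_cases h : F ω ω₀
  · rw [halfReveal_at_of_rel h]; simp [halfProb, h]
  · have h' : Quotient.mk F ω ≠ Quotient.mk F ω₀ := fun e => h (Quotient.exact e)
    simp [halfReveal, Signaling.at, h', halfProb, h, hst]

variable {G : Game n Ω} {M : ℝ} {out inn : ∀ i, G.A i} {gain : ∀ i, Ω → G.A i → ℝ}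
  {w : Ω → ℝ} {μ : Ω → ℝ}

open Classical in
/-- The profile in which, after the signal `s`, the players in the common knowledge component of
`ω₀` enter with the bet that pays nothing; otherwise they stay out. -/
noncomputable def enterProfile (P : Fin n → Setoid Ω) (ω₀ : Ω) (s : S) (out inn : ∀ i, G.A i) :
    Profile P G S := fun i c r =>
  if r = s ∧ ckcOf P i c = Quotient.mk _ ω₀ then Pi.single (inn i) 1 else Pi.single (out i) 1

lemma enterProfile_mem (i : Fin n) (c : Quotient (P i)) (r : S) :
    enterProfile P ω₀ s out inn i c r ∈ stdSimplex ℝ (G.A i) := by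
  classical
  unfold enterProfile
  split_ifs <;> convert single_mem_stdSimplex ℝ _

lemma enterProfile_of_rel {ω : Ω} (h : ckc P ω ω₀) (i : Fin n) [DecidableEq (G.A i)] :
    enterProfile P ω₀ s out inn i (Quotient.mk _ ω) s = Pi.single (inn i) 1 := by
  classical
  refine (if_pos ⟨rfl, Quotient.sound h⟩).trans ?_
  congr!

lemma enterProfile_of_not {ω : Ω} {r : S} (h : ¬ (r = s ∧ ckc P ω ω₀)) (i : Fin n)
    [DecidableEq (G.A i)] :
    enterProfile P ω₀ s out inn i (Quotient.mk _ ω) r = Pi.single (out i) 1 := by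
  classical
  refine (if_neg fun h' => h ⟨h'.1, Quotient.exact h'.2⟩).trans ?_
  congr!

lemma outcome_enterProfile_pos (hμ : ∀ ω, 0 < μ ω) :
    0 < outcome P μ (halfReveal F ω₀ s t) G (enterProfile P ω₀ s out inn) ω₀ inn := by
  classical
  unfold outcome
  rw [halfReveal_at_of_rel (Setoid.refl' _ _), Finsupp.sum_single_index (by simp)]
  simp only [enterProfile_of_rel (Setoid.refl' (ckc P) ω₀), Pi.single_eq_same]
  simpa using hμ ω₀

lemma eq_inn_of_outcome_enterProfile_ne_zero {τ : Signaling F S} (hne : ∀ i, inn i ≠ out i)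
    {ω : Ω} {a : ∀ i, G.A i} (h : outcome P μ τ G (enterProfile P ω₀ s out inn) ω a ≠ 0)
    {i : Fin n} (hi : a i = inn i) : a = inn := by
  classical
  obtain ⟨r, _, hr⟩ := Finset.exists_ne_zero_of_sum_ne_zero (right_ne_zero_of_mul h)
  have hr' := fun j => Finset.prod_ne_zero_iff.1 (right_ne_zero_of_mul hr) j (Finset.mem_univ j)
  by_cases hc : r = s ∧ ckc P ω ω₀
  · obtain ⟨rfl, hω⟩ := hc
    funext j
    by_contra hj
    exact hr' j (by rw [enterProfile_of_rel hω, Pi.single_eq_of_ne hj])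
  · refine absurd ?_ (hr' i)
    rw [enterProfile_of_not hc, hi, Pi.single_eq_of_ne (hne i)]

lemma outcome_pos_of_pos {τ : Signaling F S} (hμ : ∀ ω, 0 < μ ω) {σ : Profile P G S}
    (hσ : ∀ i c s, σ i c s ∈ stdSimplex ℝ (G.A i)) {ω : Ω} {r : S} (hr : 0 < τ.at ω r)
    {a : ∀ i, G.A i} (ha : ∀ i, 0 < σ i (Quotient.mk _ ω) r (a i)) :
    0 < outcome P μ τ G σ ω a := by
  refine mul_pos (hμ ω) (Finset.sum_pos' (fun z _ => mul_nonneg (τ.at_nonneg _ _)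
    (Finset.prod_nonneg fun j _ => (hσ _ _ _).1 _)) ⟨r, Finsupp.mem_support_iff.2 hr.ne', ?_⟩)
  exact mul_pos hr (Finset.prod_pos fun j _ => ha j)

lemma exists_pos_of_mem_stdSimplex {α : Type*} [Fintype α] {x : α → ℝ} (hx : x ∈ stdSimplex ℝ α) :
    ∃ c, 0 < x c := by
  by_contra! h
  have := Finset.sum_nonpos fun c (_ : c ∈ Finset.univ) => h c
  rw [hx.2] at this
  norm_num at this

variable [Fintype Ω]

lemma isNash_enterProfile (hn : 2 ≤ n) (hμ : ∀ ω, 0 < μ ω) (hst : s ≠ t)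
    (h : IsBettingGame P (fun z => μ z * halfProb F ω₀ z) G M out inn gain) :
    IsNash P μ (halfReveal F ω₀ s t) G (enterProfile P ω₀ s out inn) := by
  classical
  refine ⟨⟨enterProfile_mem, ?_⟩, ?_⟩
  · intro i ω r r' hrr
    by_cases hω : ckc P ω ω₀
    · -- Only `s` is possible in `ω₀`, so it shares its posteriors with no other signal.
      have hiff : r = s ↔ r' = s := by
        have := (hrr ω₀ hω).1
        rw [halfReveal_at_of_rel (Setoid.refl' _ _)] at this
        have hs : ∀ r : S, 0 < (Finsupp.single s (1 : ℝ)) r ↔ r = s := by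
          intro r
          rw [Finsupp.single_apply]
          split_ifs with hsr
          · simp [hsr]
          · simp [Ne.symm hsr]
        rwa [hs, hs] at this
      by_cases hr : r = s
      · rw [hr, hiff.1 hr]
      · rw [enterProfile_of_not (fun h => hr h.1), enterProfile_of_not (fun h => hr (hiff.2 h.1))]
    · rw [enterProfile_of_not (fun h => hω h.2), enterProfile_of_not (fun h => hω h.2)]
  · intro i ω r _ hr ρ hρ
    have hmem := fun ω' j => enterProfile_mem (P := P) (ω₀ := ω₀) (s := s) (out := out)
      (inn := inn) j (Quotient.mk _ ω') r
    by_cases hc : r = s ∧ ckc P ω ω₀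
    · obtain ⟨rfl, hω⟩ := hc
      -- Everybody else enters and all bets are fair, so every action has expected payoff zero.
      have key : ∀ ρ ∈ stdSimplex ℝ (G.A i), interimPayoff P μ (halfReveal F ω₀ r t) G
          (enterProfile P ω₀ r out inn) i ω r ρ = 0 := by
        intro ρ hρ
        have h1 : interimPayoff P μ (halfReveal F ω₀ r t) G (enterProfile P ω₀ r out inn) i ω r ρ =
            ∑ ω', posterior P μ (halfReveal F ω₀ r t) i ω r ω' * ∑ c, ρ c * gain i ω' c := by
          unfold interimPayoff
          refine Finset.sum_congr rfl fun ω' _ => ?_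
          by_cases hω' : P i ω ω'
          · rw [h.mixedPayoff_update (hmem ω') _ _ hρ, Finset.prod_eq_one, sub_self, mul_zero,
              sub_zero]
            intro j _
            rw [enterProfile_of_rel
              (Setoid.trans' _ (Setoid.symm' _ ((le_iSup P i) hω')) hω)]
            simp [(h.inn_ne_out j).symm]
          · simp [posterior, hω']
        rw [h1]
        simp only [Finset.mul_sum]
        rw [Finset.sum_comm]
        refine Finset.sum_eq_zero fun c _ => ?_
        obtain ⟨a, b, hab, hgain⟩ := h.gain_eq i c
        simp only [hgain, mul_left_comm _ (ρ c)]
        rw [← Finset.mul_sum]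
        refine mul_eq_zero_of_right _ ?_
        by_cases ha : P i ω a
        · rw [sum_posterior_mul_bet hμ r ha (Setoid.trans' _ ha hab), halfReveal_at_fst hst,
            halfReveal_at_fst hst, div_self (halfProb_pos _ _ _).ne',
            div_self (halfProb_pos _ _ _).ne', sub_self, zero_div]
        · exact sum_posterior_mul_bet_eq_zero r hab ha
      rw [key ρ hρ, key _ (hmem ω i)]
    · -- Everybody else stays out, and no bet can recover the cost of entering alone.
      have hnot : ∀ ω', P i ω ω' → ¬ (r = s ∧ ckc P ω' ω₀) := fun ω' hω' h' =>
        hc ⟨h'.1, Setoid.trans' _ ((le_iSup P i) hω') h'.2⟩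
      obtain ⟨j, hj⟩ : ∃ j : Fin n, j ≠ i := by
        have : Nontrivial (Fin n) := Fin.nontrivial_iff_two_le.2 hn
        exact exists_ne i
      unfold interimPayoff
      refine Finset.sum_le_sum fun ω' _ => ?_
      by_cases hω' : P i ω ω'
      · refine mul_le_mul_of_nonneg_left ?_ (posterior_nonneg hμ _ _ _ _)
        have h0 : ∏ j ∈ Finset.univ.erase i, (1 - enterProfile P ω₀ s out inn j
            (Quotient.mk _ ω') r (out j)) = 0 := by
          refine Finset.prod_eq_zero (Finset.mem_erase.2 ⟨hj, Finset.mem_univ j⟩) ?_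
          rw [enterProfile_of_not (hnot ω' hω')]
          simp
        rw [h.mixedPayoff_update (hmem ω') _ _ hρ, h.mixedPayoff_update (hmem ω') _ _ (hmem ω i),
          h0, enterProfile_of_not hc]
        have h1 : ∑ c, (Pi.single (out i) 1 : G.A i → ℝ) c * gain i ω' c = 0 := by
          refine Finset.sum_eq_zero fun c _ => ?_
          by_cases hco : c = out i
          · rw [hco, h.gain_out, mul_zero]
          · rw [Pi.single_eq_of_ne hco, zero_mul]
        have h2 : ∑ c, ρ c * gain i ω' c ≤ M * (1 - ρ (out i)) := by
          rw [← hρ.2, ← Finset.sum_erase_add _ _ (Finset.mem_univ (out i)),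
            ← Finset.sum_erase_add _ ρ (Finset.mem_univ (out i)), h.gain_out, mul_zero, add_zero,
            add_sub_cancel_right, Finset.mul_sum]
          refine Finset.sum_le_sum fun c _ => ?_
          rw [mul_comm]
          exact mul_le_mul_of_nonneg_right (h.gain_le _ _ _) (hρ.1 c)
        rw [h1, Pi.single_eq_same]
        linarith
      · simp [posterior, hω']

/-- If `NED` contains the outcome of joint entry on `s`, then after some signal of `τ` all players
enter throughout the component of `ω₀`: a player who enters finds all bets fair, so the signal is
possible in all states that the player holds possible, and there the others must enter as well.
Fairness of all bets makes the likelihood of the signal proportional to `halfProb`. -/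
lemma not_rel_of_mem_NED {τ : Signaling F₁ S} (hμ : ∀ ω, 0 < μ ω)
    (h : IsBettingGame P (fun z => μ z * halfProb F₂ ω₀ z) G M out inn gain)
    (hmem : outcome P μ (halfReveal F₂ ω₀ s t) G (enterProfile P ω₀ s out inn) ∈ NED P μ τ G)
    {ω : Ω} (hω : ckc P ω₀ ω) (h₂ : ¬ F₂ ω₀ ω) : ¬ F₁ ω₀ ω := by
  classical
  intro h₁
  obtain ⟨σ, hσ, hout⟩ := hmem
  have hpos := outcome_enterProfile_pos (P := P) (F := F₂) (ω₀ := ω₀) (s := s) (t := t)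
    (out := out) (inn := inn) hμ
  rw [hout] at hpos
  obtain ⟨r, hr, hr'⟩ := Finset.exists_ne_zero_of_sum_ne_zero (right_ne_zero_of_mul hpos.ne')
  have hτ : ∀ z, τ.at z r ≠ 0 → 0 < τ.at z r := fun z hz =>
    lt_of_le_of_ne (τ.at_nonneg _ _) (Ne.symm hz)
  let Good : Ω → Prop := fun z =>
    0 < τ.at z r ∧ ∀ i, 0 < σ i (Quotient.mk _ z) r (inn i)
  have hgood₀ : Good ω₀ := by
    refine ⟨hτ _ (left_ne_zero_of_mul hr'), fun i => lt_of_le_of_ne ((hσ.1.1 _ _ _).1 _) ?_⟩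
    exact Ne.symm (Finset.prod_ne_zero_iff.1 (right_ne_zero_of_mul hr') i (Finset.mem_univ i))
  have hall : ∀ z i, 0 < τ.at z r → 0 < σ i (Quotient.mk _ z) r (inn i) → Good z := by
    intro z i hz hi
    refine ⟨hz, fun j => ?_⟩
    choose a ha using fun j => exists_pos_of_mem_stdSimplex (hσ.1.1 j (Quotient.mk _ z) r)
    have hb : ∀ j, 0 < σ j (Quotient.mk _ z) r (Function.update a i (inn i) j) := by
      intro j
      by_cases hj : j = i
      · subst hj; rwa [Function.update_self]
      · rw [Function.update_of_ne hj]; exact ha j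
    have h3 := outcome_pos_of_pos hμ hσ.1.1 hz hb
    rw [← hout] at h3
    have := eq_inn_of_outcome_enterProfile_ne_zero h.inn_ne_out h3.ne' (Function.update_self i _ a)
    rw [← this]
    exact hb j
  have hstep : ∀ i z z', P i z z' → Good z →
      τ.at z r / halfProb F₂ ω₀ z = τ.at z' r / halfProb F₂ ω₀ z' ∧ Good z' := by
    intro i z z' hzz hz
    have he := h.likelihood_ratio_eq hσ hμ hz.1 (hz.2 i) hzz
    refine ⟨he, hall z' i ?_ ?_⟩
    · have := div_pos hz.1 (halfProb_pos F₂ ω₀ z)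
      rw [he] at this
      exact (div_pos_iff_of_pos_right (halfProb_pos _ _ _)).1 this
    · have hq : Quotient.mk (P i) z' = Quotient.mk _ z := Quotient.sound (Setoid.symm' _ hzz)
      rw [hq]
      exact hz.2 i
  -- The likelihood ratio, on the states where all players enter, is constant on components.
  let Φ : Ω → Option ℝ := fun z =>
    if Good z then some (τ.at z r / halfProb F₂ ω₀ z) else none
  have hΦ : ckc P ≤ Setoid.ker Φ := by
    refine iSup_le fun i z z' hzz => ?_
    change Φ z = Φ z'
    by_cases hz : Good z
    · obtain ⟨he, hz'⟩ := hstep i z z' hzz hz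
      simp only [Φ, if_pos hz, if_pos hz', he]
    · have hz' : ¬ Good z' := fun hz' => hz (hstep i z' z (Setoid.symm' _ hzz) hz').2
      simp only [Φ, if_neg hz, if_neg hz']
  have heq : Φ ω₀ = Φ ω := hΦ hω
  have hgood : Good ω := by
    by_contra hbad
    simp [Φ, hgood₀, hbad] at heq
  simp only [Φ, if_pos hgood₀, if_pos hgood, Option.some.injEq] at heq
  have hat : τ.at ω₀ = τ.at ω := congrArg τ.toFun (Quotient.sound h₁)
  have hp₀ : halfProb F₂ ω₀ ω₀ = 1 := if_pos (Setoid.refl' _ _)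
  have hp : halfProb F₂ ω₀ ω = 1 / 2 := if_neg fun h' => h₂ (Setoid.symm' _ h')
  rw [hp₀, hp, hat] at heq
  have := hgood.1
  linarith

theorem refinesInEveryCKC_of_dominates [Infinite S] (hn : 2 ≤ n) (hμ : ∀ ω, 0 < μ ω)
    (hdom : Dominates P μ S F₁ F₂) : RefinesInEveryCKC P F₁ F₂ := by
  intro ω₀ ω hω h₁
  by_contra h₂
  obtain ⟨s, t, hst⟩ := exists_pair_ne S
  have : Nonempty Ω := ⟨ω₀⟩
  obtain ⟨G, M, out, inn, gain, h⟩ := exists_isBettingGame P (fun z => μ z * halfProb F₂ ω₀ z)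
    fun z => mul_pos (hμ z) (halfProb_pos _ _ _)
  obtain ⟨τ₁, hτ₁⟩ := hdom (halfReveal F₂ ω₀ s t) G
  have hmem : outcome P μ (halfReveal F₂ ω₀ s t) G (enterProfile P ω₀ s out inn) ∈
      NED P μ τ₁ G := by
    rw [hτ₁]
    exact ⟨_, isNash_enterProfile hn hμ hst h, rfl⟩
  exact not_rel_of_mem_NED hμ h hmem hω h₂ h₁

end Necessity

end GuidedGame

theorem mainTheorem1 {n : ℕ} (hn : 2 ≤ n) {Ω : Type*} [Fintype Ω]
    (P : Fin n → Setoid Ω)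
    (μ : Ω → ℝ) (hμ_pos : ∀ ω, 0 < μ ω) (hμ_sum : ∑ ω, μ ω = 1)
    (S : Type*) [Countable S] [Infinite S]
    (F₁ F₂ : Setoid Ω) (hloop : ¬ GuidedGame.HasLoop P F₁) :
    GuidedGame.Dominates P μ S F₁ F₂ ↔ GuidedGame.RefinesInEveryCKC P F₁ F₂ := by
  exact ⟨GuidedGame.refinesInEveryCKC_of_dominates hn hμ_pos,
    GuidedGame.dominates_of_refinesInEveryCKC hloop⟩
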